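/- Let $m,N\ge 1$ be integers, let $c_1,\dots,c_m\in\mathbb{R}[\xi]=\mathbb{R}[\xi_1,\dots,\xi_m]$ be polynomials (the asset losses), and let $\gamma\ge 0$, $\eta\in(0,1]$, $R>0$, $\varepsilon>0$. Put $h_1(\xi)=R^2-\|\xi\|_2^2$ and $\Xi=\{\xi\in\mathbb{R}^m: h_1(\xi)\ge 0\}$, let $\widehat\xi_1,\dots,\widehat\xi_N\in\Xi$, let $\widehat{\mathbb{P}}=\frac1N\sum_{i=1}^N\delta_{\widehat\xi_i}$ be their empirical distribution, and let $\mathbb{B}_\varepsilon(\widehat{\mathbb{P}})$ be the set of all probability measures $\mathbb{Q}$ supported on $\Xi$ with $d_W(\mathbb{Q},\widehat{\mathbb{P}})\le\varepsilon$, where $d_W$ is the Wasserstein distance of order $2$ for the Euclidean norm. Let $\Delta=\{y\in\mathbb{R}^m_+:\sum_{p}y_p=1\}$ and, for $y\in\Delta$ and $\tau\in\mathbb{R}$, $$g^{(1)}_{y,\tau}=\sum_{p=1}^m y_pc_p+\gamma\tau,\qquad g^{(2)}_{y,\tau}=\Bigl(1+\frac{\gamma}{\eta}\Bigr)\sum_{p=1}^m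 y_pc_p+\Bigl(1-\frac1\eta\Bigr)\gamma\tau .$$ Consider the Wasserstein distributionally robust mean-CVaR problem $$(\mathrm{PP})\qquad \inf_{y\in\Delta,\ \tau\in\mathbb{R}}\ \sup_{\mathbb{Q}\in\mathbb{B}_\varepsilon(\widehat{\mathbb{P}})}\ \mathbb{E}^{\mathbb{Q}}\Bigl[\max_{k\in\{1,2\}}g^{(k)}_{y,\tau}(\xi)\Bigr]$$ with optimal value $\mathrm{val}(\mathrm{PP})$. A solution of (PP) is a triple $(y^\star,\tau^\star,\mathbb{Q}^\star)\in\Delta\times\mathbb{R}\times\mathbb{B}_\varepsilon(\widehat{\mathbb{P}})$ with $\mathbb{E}^{\mathbb{Q}^\star}[\max_k g^{(k)}_{y^\star,\tau^\star}(\xi)]=\mathrm{val}(\mathrm{PP})$. Let $\Sigma^2$ be the set of sums of squares of polynomials in $\mathbb{R}[\xi]$, $\Sigma^2_{2r}$ the set of those of degree at most $2r$, and $\varphi_i(\xi)=\|\xi-\widehat\xi_i\|_2^2$. For each $r\in\mathbb{N}$ with $2r\ge\max\{\max_p\deg c_p,\,2\}$ let $(\mathrm{PD}_r)$ be the problem of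 minimizing $$\lambda\varepsilon^2-\frac1N\sum_{i=1}^N\alpha_i$$ over $y\in\Delta$, $\tau\in\mathbb{R}$, $\lambda\ge 0$, $\alpha_i\in\mathbb{R}$ and $\sigma_i^{(k)}\in\Sigma^2$ ($i=1,\dots,N$, $k=1,2$) subject to $$-g^{(k)}_{y,\tau}+\lambda\varphi_i-\alpha_i-\sigma_i^{(k)}h_1\in\Sigma^2_{2r},\qquad \deg\sigma_i^{(k)}\le 2(r-1)\qquad\text{for all } i,k .$$ Assume that (PP) has a solution and that $(\mathrm{PD}_r)$ has a minimizer for every such $r$. Then for every such $r$ $$\min(\mathrm{PD}_r)\ \ge\ \min(\mathrm{PD}_{r+1})\ \ge\ \mathrm{val}(\mathrm{PP}),\qquad\text{and}\qquad \lim_{r\to\infty}\min(\mathrm{PD}_r)=\mathrm{val}(\mathrm{PP}).$$ -/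

import Mathlib

open MeasureTheory Filter Topology

open scoped ENNReal

noncomputable section

namespace PortfolioDRO

/-- `π` is a joint distribution with marginals `μ` and `ν`. If `μ` and `ν` are probability measures
concentrated on a measurable set `S`, then `π` is a probability measure concentrated on `S × S`. -/
def IsCoupling {E : Type*} [MeasurableSpace E] (π : Measure (E × E)) (μ ν : Measure E) : Prop :=
  π.map Prod.fst = μ ∧ π.map Prod.snd = ν

/-- The Wasserstein distance of order 2: the infimum, over all couplings, of the square root of the
quadratic transport cost. -/
def wasserstein {E : Type*} [MeasurableSpace E] [PseudoEMetricSpace E] (μ ν : Measure E) : ℝ≥0∞ :=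
  ⨅ (π : Measure (E × E)) (_ : IsCoupling π μ ν),
    (∫⁻ p, edist p.1 p.2 ^ 2 ∂π) ^ (1 / 2 : ℝ)

/-- The data of the portfolio problem with `m` assets and `N` past realizations: the polynomial asset
losses `c p`, the risk aversion `γ`, the CVaR level `η`, the radius `R` of the support ball, the
Wasserstein radius `ε`, and the past realizations `data i`. -/
structure Model (m N : ℕ) where
  c : Fin m → MvPolynomial (Fin m) ℝ
  γ : ℝ
  η : ℝ
  R : ℝ
  ε : ℝ
  data : Fin N → EuclideanSpace ℝ (Fin m)

/-- The decision variables of the relaxations: portfolio weights `y`, the CVaR variable `τ`, the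
multipliers `lam` and `α i`, and the polynomials `σ k i` (`k = 0, 1` for the two loss pieces). -/
structure Decision (m N : ℕ) where
  y : Fin m → ℝ
  τ : ℝ
  lam : ℝ
  α : Fin N → ℝ
  σ : Fin 2 → Fin N → MvPolynomial (Fin m) ℝ

namespace Model

variable {m N : ℕ} (P : Model m N)

/-- The portfolio loss `∑ p, y p * c p`. -/
def loss (y : Fin m → ℝ) : MvPolynomial (Fin m) ℝ :=
  ∑ p, MvPolynomial.C (y p) * P.c p

/-- The two polynomial pieces of the mean-CVaR loss. -/
def g (k : Fin 2) (y : Fin m → ℝ) (τ : ℝ) : MvPolynomial (Fin m) ℝ :=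
  match k with
  | 0 => P.loss y + MvPolynomial.C (P.γ * τ)
  | 1 => MvPolynomial.C (1 + P.γ / P.η) * P.loss y + MvPolynomial.C ((1 - 1 / P.η) * P.γ * τ)

/-- The polynomial `R² - ‖ξ‖²`. -/
def h : MvPolynomial (Fin m) ℝ :=
  MvPolynomial.C (P.R ^ 2) - ∑ j, MvPolynomial.X j ^ 2

/-- The polynomial `‖ξ - data i‖²`. -/
def φ (i : Fin N) : MvPolynomial (Fin m) ℝ :=
  ∑ j, (MvPolynomial.X j - MvPolynomial.C (P.data i j)) ^ 2

/-- The ball support set, where `R² - ‖ξ‖² ≥ 0`. -/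
def support : Set (EuclideanSpace ℝ (Fin m)) :=
  {x | 0 ≤ MvPolynomial.eval (fun j => x j) P.h}

/-- The empirical distribution of the past realizations. -/
def empirical : Measure (EuclideanSpace ℝ (Fin m)) :=
  (N : ℝ≥0∞)⁻¹ • ∑ i, Measure.dirac (P.data i)

/-- The Wasserstein ball: probability measures supported on the support set at Wasserstein distance
at most `ε` from the empirical distribution. -/
def ambiguitySet : Set (Measure (EuclideanSpace ℝ (Fin m))) :=
  {Q | IsProbabilityMeasure Q ∧ Q P.supportᶜ = 0 ∧
    wasserstein Q P.empirical ≤ ENNReal.ofReal P.ε}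

/-- The expectation under `Q` of the larger of the two loss pieces. -/
def expectedLoss (y : Fin m → ℝ) (τ : ℝ) (Q : Measure (EuclideanSpace ℝ (Fin m))) : ℝ :=
  ∫ x, max (MvPolynomial.eval (fun j => x j) (P.g 0 y τ))
    (MvPolynomial.eval (fun j => x j) (P.g 1 y τ)) ∂Q

/-- The value of the distributionally robust problem
`inf_{y ∈ Δ, τ} sup_{Q ∈ ambiguitySet} E^Q[max_k g_k]`, as an extended real number. -/
def droValue : EReal :=
  ⨅ y ∈ stdSimplex ℝ (Fin m), ⨅ τ : ℝ, ⨆ Q ∈ P.ambiguitySet, (P.expectedLoss y τ Q : EReal)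

/-- A solution of the min-max problem: a feasible triple at which the value is attained. -/
def IsSolution (y : Fin m → ℝ) (τ : ℝ) (Q : Measure (EuclideanSpace ℝ (Fin m))) : Prop :=
  y ∈ stdSimplex ℝ (Fin m) ∧ Q ∈ P.ambiguitySet ∧ (P.expectedLoss y τ Q : EReal) = P.droValue

/-- The levels at which the relaxation is defined: `2r ≥ max (max_p deg (c p)) 2`. -/
def IsLevel (r : ℕ) : Prop :=
  2 ≤ 2 * r ∧ ∀ p, (P.c p).totalDegree ≤ 2 * r

/-- The feasible set of the relaxation of level `r`. -/
def feasible (r : ℕ) : Set (Decision m N) :=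
  {z | z.y ∈ stdSimplex ℝ (Fin m) ∧ 0 ≤ z.lam ∧
    ∀ (k : Fin 2) (i : Fin N),
      IsSumSq (z.σ k i) ∧ (z.σ k i).totalDegree ≤ 2 * (r - 1) ∧
      IsSumSq (-P.g k z.y z.τ + MvPolynomial.C z.lam * P.φ i - MvPolynomial.C (z.α i)
        - z.σ k i * P.h) ∧
      (-P.g k z.y z.τ + MvPolynomial.C z.lam * P.φ i - MvPolynomial.C (z.α i)
        - z.σ k i * P.h).totalDegree ≤ 2 * r}

/-- The objective `λ ε² - (1/N) ∑ i, α i` of the relaxations. -/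
def objective (z : Decision m N) : ℝ :=
  z.lam * P.ε ^ 2 - 1 / (N : ℝ) * ∑ i, z.α i

/-- A minimizer of the relaxation of level `r`. -/
def IsMinimizer (r : ℕ) (z : Decision m N) : Prop :=
  z ∈ P.feasible r ∧ IsMinOn P.objective (P.feasible r) z

/-- The optimal value of the relaxation of level `r`, as an extended real number. -/
def relaxValue (r : ℕ) : EReal :=
  ⨅ z ∈ P.feasible r, (P.objective z : EReal)

end Model

end PortfolioDRO

end

/-! Upper bound: a feasible certificate forces both loss pieces below `λ‖ξ - ξ̂ᵢ‖² - αᵢ` on the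
ball. Integrating against nearly optimal couplings bounds the expected loss, uniformly over the
ambiguity set, by the objective (`expectedLoss_le_objective`). Feasible sets grow with `r`, so the
values decrease.

Convergence: fix `(y, τ)` with worst case below `w`. Strong duality (`exists_dual_certificate`)
yields `λ, α` with nonnegative dual polynomials on the ball and objective below `w`. Spending the
slack on `α` makes these polynomials strictly positive, so Putinar's theorem gives sum-of-squares
certificates of some finite degree, feasible for all large `r`.

Putinar's theorem rests on `Σ² + Σ²h` being an archimedean semiring. An element outside it is
nonpositive at some state, hence at an extreme state; extreme states are multiplicative, so they are
evaluations at points of the ball. -/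

namespace ArchimedeanSemiring

/-! ### States of archimedean semirings. -/

variable {A : Type*} [CommRing A] [Algebra ℝ A]

/-- The states of a subset `T` of an algebra: the linear functionals that are nonnegative on `T` and
normalized at `1`, as a subset of the function space. -/
def states (T : Set A) : Set (A → ℝ) :=
  {L | (∀ a b, L (a + b) = L a + L b) ∧ (∀ (r : ℝ) a, L (r • a) = r * L a) ∧
    (∀ t ∈ T, 0 ≤ L t) ∧ L 1 = 1}

theorem isClosed_states (T : Set A) : IsClosed (states T) := by
  have e (a : A) : Continuous fun L : A → ℝ => L a := continuous_apply a
  simp only [states, Set.ofPred_and, Set.ofPred_forall]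
  refine .inter ?_ (.inter ?_ (.inter ?_ ?_))
  · exact isClosed_iInter fun a => isClosed_iInter fun b => isClosed_eq (e _) ((e a).add (e b))
  · exact isClosed_iInter fun r => isClosed_iInter fun a =>
      isClosed_eq (e _) (continuous_const.mul (e a))
  · exact isClosed_iInter fun t => isClosed_iInter fun _ => isClosed_le continuous_const (e t)
  · exact isClosed_eq (e 1) continuous_const

variable {T : Subsemiring A}

theorem smul_mem (hpos : ∀ r : ℝ, 0 ≤ r → algebraMap ℝ A r ∈ T) {r : ℝ} (hr : 0 ≤ r) {t : A}
    (ht : t ∈ T) : r • t ∈ T := by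
  rw [Algebra.smul_def]
  exact T.mul_mem (hpos r hr) ht

/-- In an archimedean semiring every element is bounded on both sides by a positive scalar. -/
theorem exists_bound (hpos : ∀ r : ℝ, 0 ≤ r → algebraMap ℝ A r ∈ T)
    (harch : ∀ a : A, ∃ r : ℝ, algebraMap ℝ A r + a ∈ T) (a : A) :
    ∃ r : ℝ, 0 < r ∧ algebraMap ℝ A r + a ∈ T ∧ algebraMap ℝ A r - a ∈ T := by
  obtain ⟨r, hr⟩ := harch a
  obtain ⟨s, hs⟩ := harch (-a)
  refine ⟨max (max r s) 1, by positivity, ?_, ?_⟩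
  · have := T.add_mem (hpos (max (max r s) 1 - r) (sub_nonneg.2 (by simp))) hr
    rw [map_sub] at this
    convert this using 1; ring
  · have := T.add_mem (hpos (max (max r s) 1 - s) (sub_nonneg.2 (by simp))) hs
    rw [map_sub] at this
    convert this using 1; ring

/-- The archimedean bound confines each coordinate `L a` to an interval, so Tychonoff applies. -/
theorem isCompact_states (hpos : ∀ r : ℝ, 0 ≤ r → algebraMap ℝ A r ∈ T)
    (harch : ∀ a : A, ∃ r : ℝ, algebraMap ℝ A r + a ∈ T) : IsCompact (states (T : Set A)) := by
  choose r hr0 hr1 hr2 using exists_bound hpos harch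
  refine (isCompact_univ_pi fun a => isCompact_Icc (a := -r a) (b := r a)).of_isClosed_subset
    (isClosed_states _) ?_
  rintro L ⟨hadd, hsmul, hT, h1⟩ a -
  have hc (s : ℝ) : L (algebraMap ℝ A s) = s := by
    rw [Algebra.algebraMap_eq_smul_one, hsmul, h1, mul_one]
  have hneg : L (-a) = -L a := by simpa using hsmul (-1) a
  have e1 := hT _ (hr1 a)
  have e2 := hT _ (hr2 a)
  rw [sub_eq_add_neg] at e2
  rw [hadd, hc] at e1 e2
  rw [hneg] at e2
  constructor <;> linarith

/-- Extreme states of an archimedean semiring are multiplicative. -/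
theorem map_mul_of_mem_extremePoints (hpos : ∀ r : ℝ, 0 ≤ r → algebraMap ℝ A r ∈ T)
    (harch : ∀ a : A, ∃ r : ℝ, algebraMap ℝ A r + a ∈ T) {L : A → ℝ}
    (hL : L ∈ (states (T : Set A)).extremePoints ℝ) (a b : A) : L (a * b) = L a * L b := by
  obtain ⟨⟨hadd, hsmul, hT, h1⟩, hext⟩ := mem_extremePoints.1 hL
  obtain ⟨r, hr, hp, hm⟩ := exists_bound hpos harch a
  have hc (s : ℝ) : L (algebraMap ℝ A s) = s := by
    rw [Algebra.algebraMap_eq_smul_one, hsmul, h1, mul_one]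
  have hneg (x : A) : L (-x) = -L x := by simpa using hsmul (-1) x
  have hcm (s : ℝ) (x : A) : L (algebraMap ℝ A s * x) = s * L x := by
    rw [← Algebra.smul_def, hsmul]
  have e1 := hT _ hp
  have e2 := hT _ hm
  rw [sub_eq_add_neg, hadd, hc, hneg] at e2
  rw [hadd, hc] at e1
  -- Multiplying the argument by `u + 1 ∈ T` and renormalizing gives a state; the shift by `1` keeps
  -- the normalizer positive even if `L u = 0`.
  have key (u : A) (hu : u ∈ T) :
      (fun x => (L u + 1)⁻¹ * L ((u + algebraMap ℝ A 1) * x)) ∈ states (T : Set A) := by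
    have hu0 := hT u hu
    have hne : L u + 1 ≠ 0 := by positivity
    refine ⟨fun x y => ?_, fun c x => ?_, fun t ht => ?_, ?_⟩
    · simp only [mul_add, hadd]
    · simp only [mul_smul_comm, hsmul]; ring
    · exact mul_nonneg (by positivity)
        (hT _ (T.mul_mem (T.add_mem hu (hpos 1 zero_le_one)) ht))
    · simp only [mul_one, hadd, hc]
      exact inv_mul_cancel₀ hne
  have hs1 := key _ hp
  have hs2 := key _ hm
  have hl1 : L (algebraMap ℝ A r + a) = r + L a := by rw [hadd, hc]
  have hl2 : L (algebraMap ℝ A r - a) = r - L a := by rw [sub_eq_add_neg, hadd, hc, hneg]; ring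
  rw [hl1] at hs1
  rw [hl2] at hs2
  have q1 : 0 < r + L a + 1 := by linarith
  have q2 : 0 < r - L a + 1 := by linarith
  -- Since `(r + a + 1) + (r - a + 1) = 2r + 2`, `L` is a convex combination of the states for `u =
  -- r ± a`. Extremality equates `L` with the first, which is multiplicativity by `a`.
  have heq := (hext _ hs1 _ hs2 ⟨(r + L a + 1) / (2 * r + 2), (r - L a + 1) / (2 * r + 2),
    by positivity, by positivity, by field_simp; ring, ?_⟩).1
  · have := congrFun heq b
    simp only [add_mul, hadd, hcm] at this
    field_simp at this
    linarith
  · funext x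
    simp only [Pi.add_apply, Pi.smul_apply, smul_eq_mul, add_mul, sub_eq_add_neg, hadd,
      hneg, hcm, neg_mul]
    field_simp
    ring

/-- An element outside an archimedean semiring is nonpositive at some state. -/
theorem exists_mem_states_nonpos (hpos : ∀ r : ℝ, 0 ≤ r → algebraMap ℝ A r ∈ T)
    (harch : ∀ a : A, ∃ r : ℝ, algebraMap ℝ A r + a ∈ T) {f : A} (hf : f ∉ T) :
    ∃ L ∈ states (T : Set A), L f ≤ 0 := by
  -- The cone `T - ℝ≥0 f` contains `-f`, so a functional nonnegative on it is nonpositive at `f`.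
  let s : PointedCone ℝ A :=
    { carrier := {x | ∃ t ∈ T, ∃ r : ℝ, 0 ≤ r ∧ x = t - r • f}
      zero_mem' := ⟨0, T.zero_mem, 0, le_rfl, by simp⟩
      smul_mem' := by
        rintro c x ⟨t, ht, r, hr, rfl⟩
        exact ⟨(c : ℝ) • t, smul_mem hpos c.2 ht, c * r, mul_nonneg c.2 hr,
          by rw [mul_smul, ← smul_sub]; rfl⟩
      add_mem' := by
        rintro x y ⟨t, ht, r, hr, rfl⟩ ⟨t', ht', r', hr', rfl⟩
        exact ⟨t + t', T.add_mem ht ht', r + r', by positivity, by rw [add_smul]; abel⟩ }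
  have hTs {t : A} (ht : t ∈ T) : t ∈ s := ⟨t, ht, 0, le_rfl, by simp⟩
  have hneg (c : ℝ) (hc : c < 0) : c • (1 : A) ∉ s := by
    rintro ⟨t, ht, r, hr, h⟩
    have h' : r • f = t + (-c) • (1 : A) := by rw [neg_smul, h]; abel
    rcases hr.eq_or_lt with rfl | hr
    -- Here `T` contains a negative scalar, hence all of them, and the archimedean property puts `f`
    -- in `T`.
    · obtain ⟨k, hk0, -, hk⟩ := exists_bound hpos harch (-f)
      refine hf ?_
      have ht' : t = c • (1 : A) := by rw [h]; simp
      have := T.add_mem (smul_mem hpos (r := k / (-c)) (div_nonneg hk0.le (by linarith)) ht) hk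
      rw [ht', smul_smul, Algebra.algebraMap_eq_smul_one, ← add_sub_assoc, ← add_smul] at this
      rw [show k / (-c) * c + k = 0 by field_simp [hc.ne]; ring] at this
      simpa using this
    · refine hf ?_
      have : f = r⁻¹ • (t + (-c) • (1 : A)) := by
        rw [← h', smul_smul, inv_mul_cancel₀ hr.ne', one_smul]
      rw [this]
      exact smul_mem hpos (by positivity)
        (T.add_mem ht (smul_mem hpos (by linarith) T.one_mem))
  have h1 : (1 : A) ≠ 0 := by
    intro h
    exact hneg (-1) (by norm_num) (by rw [h, smul_zero]; exact hTs T.zero_mem)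
  let F : A →ₗ.[ℝ] ℝ := LinearPMap.mkSpanSingleton (1 : A) (1 : ℝ) h1
  have happ (c : ℝ) (hx : c • (1 : A) ∈ F.domain) : F ⟨c • (1 : A), hx⟩ = c := by
    refine (LinearPMap.mkSpanSingleton'_apply _ _ _ _ _).trans ?_
    simp
  obtain ⟨g, hg, hgs⟩ := riesz_extension s F (by
      rintro ⟨x, hx⟩ hxs
      obtain ⟨c, rfl⟩ := Submodule.mem_span_singleton.1 hx
      by_contra! hc
      rw [happ c hx] at hc
      exact hneg c hc hxs) (by
      intro y
      obtain ⟨r, hr⟩ := harch y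
      refine ⟨⟨r • 1, Submodule.smul_mem _ _ (Submodule.mem_span_singleton_self _)⟩, hTs ?_⟩
      rw [Algebra.algebraMap_eq_smul_one] at hr
      exact hr)
  refine ⟨g, ⟨map_add g, fun r a => by simp, fun t ht => hgs t (hTs ht), ?_⟩, ?_⟩
  · have h2 := hg ⟨(1 : ℝ) • 1,
      Submodule.smul_mem _ _ (Submodule.mem_span_singleton_self _)⟩
    rw [happ] at h2
    simpa using h2
  · have := hgs (-f) ⟨0, T.zero_mem, 1, zero_le_one, by simp⟩
    rw [map_neg] at this
    linarith

/-- Representation theorem for archimedean semirings: an element that is positive at every character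
nonnegative on the semiring belongs to the semiring. -/
theorem mem_of_forall_algHom_pos (hpos : ∀ r : ℝ, 0 ≤ r → algebraMap ℝ A r ∈ T)
    (harch : ∀ a : A, ∃ r : ℝ, algebraMap ℝ A r + a ∈ T) {f : A}
    (hf : ∀ χ : A →ₐ[ℝ] ℝ, (∀ t ∈ T, 0 ≤ χ t) → 0 < χ f) : f ∈ T := by
  by_contra hfT
  obtain ⟨L₀, hL₀, hL₀f⟩ := exists_mem_states_nonpos hpos harch hfT
  have hK := isCompact_states hpos harch
  have hcont : Continuous fun L : A → ℝ => L f := continuous_apply f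
  obtain ⟨L₁, hL₁, hmin⟩ := hK.exists_isMinOn ⟨L₀, hL₀⟩ hcont.continuousOn
  -- The minimizers of `L ↦ L f` form a compact face; Krein–Milman gives it an extreme point, which
  -- is then extreme among all states.
  have hF : IsCompact (states (T : Set A) ∩ {L | L f = L₁ f}) :=
    hK.inter_right (isClosed_eq hcont continuous_const)
  obtain ⟨L, hL⟩ := hF.extremePoints_nonempty ⟨L₁, hL₁, rfl⟩
  obtain ⟨⟨hLK, hLf⟩, hLext⟩ := mem_extremePoints.1 hL
  have hLK' : L ∈ (states (T : Set A)).extremePoints ℝ := by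
    refine mem_extremePoints.2 ⟨hLK, fun x₁ hx₁ x₂ hx₂ hx => ?_⟩
    obtain ⟨u, v, hu, hv, huv, hx'⟩ := id hx
    have e := congrFun hx' f
    simp only [Pi.add_apply, Pi.smul_apply, smul_eq_mul] at e
    have m1 : L₁ f ≤ x₁ f := hmin hx₁
    have m2 : L₁ f ≤ x₂ f := hmin hx₂
    have hLf' : L f = L₁ f := hLf
    have hv' : v = 1 - u := by linarith
    refine hLext _ ⟨hx₁, ?_⟩ _ ⟨hx₂, ?_⟩ hx
    · refine le_antisymm ?_ m1
      subst hv'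
      nlinarith
    · refine le_antisymm ?_ m2
      have hu' : u = 1 - v := by linarith
      subst hu'
      nlinarith
  obtain ⟨hadd, hsmul, hT, h1⟩ := hLK
  let χ : A →ₐ[ℝ] ℝ := AlgHom.ofLinearMap
    { toFun := L, map_add' := hadd, map_smul' := fun r a => by simpa using hsmul r a }
    h1 (map_mul_of_mem_extremePoints hpos harch hLK')
  have h2 : 0 < L f := hf χ hT
  have h3 : L₁ f ≤ L₀ f := hmin hL₀
  have hLf' : L f = L₁ f := hLf
  linarith

end ArchimedeanSemiring

/-! ### Putinar's theorem on the ball. -/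

namespace ArchimedeanSemiring

variable {A : Type*} [CommRing A]

/-- The preordering `Σ² + Σ² h` generated by one element. -/
def sumSqAdjoin (h : A) : Subsemiring A where
  carrier := {a | ∃ s t, IsSumSq s ∧ IsSumSq t ∧ a = s + t * h}
  zero_mem' := ⟨0, 0, .zero, .zero, by simp⟩
  one_mem' := ⟨1, 0, by simp, .zero, by simp⟩
  add_mem' := by
    rintro _ _ ⟨s, t, hs, ht, rfl⟩ ⟨s', t', hs', ht', rfl⟩
    exact ⟨s + s', t + t', hs.add hs', ht.add ht', by ring⟩
  -- With one generator the cross term `t t' h²` is again a sum of squares.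
  mul_mem' := by
    rintro _ _ ⟨s, t, hs, ht, rfl⟩ ⟨s', t', hs', ht', rfl⟩
    exact ⟨s * s' + t * t' * (h * h), s * t' + t * s',
      (hs.mul hs').add ((ht.mul ht').mul (.mul_self h)), (hs.mul ht').add (ht.mul hs'), by ring⟩

theorem mem_sumSqAdjoin_of_isSumSq (h : A) {s : A} (hs : IsSumSq s) : s ∈ sumSqAdjoin h :=
  ⟨s, 0, hs, .zero, by simp⟩

theorem self_mem_sumSqAdjoin (h : A) : h ∈ sumSqAdjoin h :=
  ⟨0, 1, .zero, by simp, by simp⟩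

variable [Algebra ℝ A]

theorem algebraMap_mem_sumSqAdjoin (h : A) (r : ℝ) (hr : 0 ≤ r) :
    algebraMap ℝ A r ∈ sumSqAdjoin h := by
  refine mem_sumSqAdjoin_of_isSumSq h ?_
  rw [← Real.mul_self_sqrt hr, map_mul]
  exact .mul_self _

/-- Products of elements bounded on both sides in a semiring are bounded on both sides. -/
theorem bound_mul {T : Subsemiring A} (hpos : ∀ r : ℝ, 0 ≤ r → algebraMap ℝ A r ∈ T) {a b : A}
    (ha : ∃ r : ℝ, algebraMap ℝ A r + a ∈ T ∧ algebraMap ℝ A r - a ∈ T)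
    (hb : ∃ r : ℝ, algebraMap ℝ A r + b ∈ T ∧ algebraMap ℝ A r - b ∈ T) :
    ∃ r : ℝ, algebraMap ℝ A r + a * b ∈ T ∧ algebraMap ℝ A r - a * b ∈ T := by
  obtain ⟨r, h1, h2⟩ := ha
  obtain ⟨s, h3, h4⟩ := hb
  have half (x : A) (hx : x + x ∈ T) : x ∈ T := by
    have := smul_mem hpos (r := 1 / 2) (by norm_num) hx
    rwa [← two_smul ℝ x, smul_smul, one_div, inv_mul_cancel₀ two_ne_zero, one_smul] at this
  -- `(r + a)(s + b) + (r - a)(s - b) = 2(rs + ab)`, and likewise with `b` negated.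
  refine ⟨r * s, half _ ?_, half _ ?_⟩
  · convert T.add_mem (T.mul_mem h1 h3) (T.mul_mem h2 h4) using 1
    rw [map_mul]; ring
  · convert T.add_mem (T.mul_mem h1 h4) (T.mul_mem h2 h3) using 1
    rw [map_mul]; ring

end ArchimedeanSemiring

open ArchimedeanSemiring in
/-- Putinar's Positivstellensatz on a ball. -/
theorem exists_isSumSq_add_mul_of_pos_on_ball {m : ℕ} {R : ℝ} (hR : 0 < R)
    (f : MvPolynomial (Fin m) ℝ)
    (hf : ∀ x : Fin m → ℝ, ∑ j, x j ^ 2 ≤ R ^ 2 → 0 < MvPolynomial.eval x f) :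
    ∃ s t : MvPolynomial (Fin m) ℝ, IsSumSq s ∧ IsSumSq t ∧
      f = s + t * (MvPolynomial.C (R ^ 2) - ∑ j, MvPolynomial.X j ^ 2) := by
  set h : MvPolynomial (Fin m) ℝ := MvPolynomial.C (R ^ 2) - ∑ j, MvPolynomial.X j ^ 2 with hh
  have hpos := algebraMap_mem_sumSqAdjoin h
  have hX (j : Fin m) : MvPolynomial.C (R ^ 2) - MvPolynomial.X j ^ 2 ∈ sumSqAdjoin h := by
    have := (sumSqAdjoin h).add_mem (self_mem_sumSqAdjoin h)
      ((sumSqAdjoin h).sum_mem (t := Finset.univ.erase j) (f := fun i => MvPolynomial.X i ^ 2)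
        fun i _ => mem_sumSqAdjoin_of_isSumSq h (by rw [sq]; exact .mul_self _))
    convert this using 1
    have e := Finset.add_sum_erase Finset.univ
      (fun i => (MvPolynomial.X i : MvPolynomial (Fin m) ℝ) ^ 2) (Finset.mem_univ j)
    rw [hh]
    linear_combination -e
  -- `(R² - u²) + (R + u)² = 2R(R + u)`.
  have hlin (u : MvPolynomial (Fin m) ℝ) (hu : MvPolynomial.C (R ^ 2) - u ^ 2 ∈ sumSqAdjoin h) :
      algebraMap ℝ _ R + u ∈ sumSqAdjoin h := by
    have := smul_mem hpos (r := 1 / (2 * R)) (by positivity) ((sumSqAdjoin h).add_mem hu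
      (mem_sumSqAdjoin_of_isSumSq h (.mul_self (MvPolynomial.C R + u))))
    convert this using 1
    have e : MvPolynomial.C (R ^ 2) - u ^ 2 + (MvPolynomial.C R + u) * (MvPolynomial.C R + u)
        = (2 * R) • (MvPolynomial.C R + u) := by
      rw [MvPolynomial.smul_eq_C_mul]
      simp only [map_pow, map_mul, map_ofNat]
      ring
    rw [e, smul_smul, one_div, inv_mul_cancel₀ (by positivity), one_smul]
    rfl
  have hbound (p : MvPolynomial (Fin m) ℝ) : ∃ r : ℝ,
      algebraMap ℝ _ r + p ∈ sumSqAdjoin h ∧ algebraMap ℝ _ r - p ∈ sumSqAdjoin h := by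
    induction p using MvPolynomial.induction_on with
    | C a =>
      refine ⟨|a|, ?_, ?_⟩
      · convert hpos (|a| + a) (by linarith [neg_abs_le a]) using 1
        rw [map_add]; rfl
      · convert hpos (|a| - a) (by linarith [le_abs_self a]) using 1
        rw [map_sub]; rfl
    | add p q hp hq =>
      obtain ⟨r, h1, h2⟩ := hp
      obtain ⟨s, h3, h4⟩ := hq
      refine ⟨r + s, ?_, ?_⟩
      · convert (sumSqAdjoin h).add_mem h1 h3 using 1
        rw [map_add]; ring
      · convert (sumSqAdjoin h).add_mem h2 h4 using 1
        rw [map_add]; ring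
    | mul_X p j hp =>
      refine bound_mul hpos hp ⟨R, hlin _ (hX j), ?_⟩
      rw [sub_eq_add_neg]
      exact hlin _ (by rw [neg_sq]; exact hX j)
  refine mem_of_forall_algHom_pos hpos (fun p => (hbound p).imp fun r hr => hr.1) fun χ hχ => ?_
  -- Characters of the polynomial ring are point evaluations; nonnegativity at `h` places the point
  -- in the ball.
  have e (p) : χ p = MvPolynomial.eval (fun j => χ (MvPolynomial.X j)) p := by
    rw [← MvPolynomial.coe_aeval_eq_eval]
    exact DFunLike.congr_fun (MvPolynomial.algHom_ext (f := χ)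
      (g := MvPolynomial.aeval fun j => χ (MvPolynomial.X j)) fun i => by simp) p
  have h0 := hχ h (self_mem_sumSqAdjoin h)
  rw [e] at h0 ⊢
  refine hf _ ?_
  simpa [hh] using h0

/-! ### Lagrange multipliers and finitely supported measures. -/

/-- A convex-combination inequality on pairs of points yields a Lagrange multiplier. -/
theorem exists_multiplier {X : Type*} (a b : X → ℝ) {c v : ℝ} (hslater : ∃ x, a x < c)
    (h : ∀ x x' w, 0 ≤ w → w ≤ 1 → w * a x + (1 - w) * a x' ≤ c →
      w * b x + (1 - w) * b x' ≤ v) :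
    ∃ l : ℝ, 0 ≤ l ∧ ∀ x, b x - l * a x ≤ v - l * c := by
  have hle (x) (hx : a x ≤ c) : b x ≤ v := by simpa using h x x 1 zero_le_one le_rfl (by simpa)
  obtain ⟨x₀, hx₀⟩ := hslater
  -- Points with `a x > c` bound `l` from below, points with `a x < c` from above; the Slater point
  -- makes the upper family nonempty.
  obtain ⟨l, hl1, hl2⟩ := exists_between_of_forall_le
    (s := insert 0 ((fun x => (b x - v) / (a x - c)) '' {x | c < a x}))
    (t := (fun x => (v - b x) / (c - a x)) '' {x | a x < c}) (Set.insert_nonempty _ _)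
    ⟨_, x₀, hx₀, rfl⟩ (by
      rintro _ (rfl | ⟨x, hx, rfl⟩) _ ⟨y, hy, rfl⟩
      · exact div_nonneg (sub_nonneg.2 (hle y hy.le)) (sub_nonneg.2 (le_of_lt hy))
      · have hx' : 0 < a x - c := sub_pos.2 hx
        have hy' : 0 < c - a y := sub_pos.2 hy
        have hd : 0 < a x - a y := by linarith
        -- This weight makes the mixed cost exactly `c`.
        have := h x y ((c - a y) / (a x - a y)) (by positivity)
          ((div_le_one hd).2 (by linarith)) (le_of_eq (by field_simp; ring))
        have e : (c - a y) / (a x - a y) * b x + (1 - (c - a y) / (a x - a y)) * b y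
          = ((c - a y) * b x + (a x - c) * b y) / (a x - a y) := by field_simp; ring
        rw [e, div_le_iff₀ hd] at this
        simp only
        rw [div_le_div_iff₀ hx' hy']
        linarith)
  refine ⟨l, hl1 (Set.mem_insert _ _), fun x => ?_⟩
  rcases lt_trichotomy (a x) c with hx | hx | hx
  · have := hl2 ⟨x, hx, rfl⟩
    simp only at this
    rw [le_div_iff₀ (sub_pos.2 hx)] at this
    linarith
  · have := hle x hx.le
    rw [hx]; linarith
  · have := hl1 (Set.mem_insert_of_mem _ ⟨x, hx, rfl⟩)
    simp only at this
    rw [div_le_iff₀ (sub_pos.2 hx)] at this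
    linarith

/-- The uniform distribution on the values of a finite family. -/
noncomputable def familyMeasure {N : ℕ} {E : Type*} [MeasurableSpace E] (x : Fin N → E) : Measure E :=
  (N : ℝ≥0∞)⁻¹ • ∑ i, Measure.dirac (x i)

section FamilyMeasure

variable {N : ℕ} {E : Type*} [MeasurableSpace E]

theorem isProbabilityMeasure_familyMeasure (hN : 0 < N) (x : Fin N → E) :
    IsProbabilityMeasure (familyMeasure x) := by
  constructor
  simp [familyMeasure, ENNReal.inv_mul_cancel, hN.ne']

theorem map_familyMeasure {F : Type*} [MeasurableSpace F] {f : E → F} (hf : Measurable f)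
    (x : Fin N → E) : (familyMeasure x).map f = familyMeasure fun i => f (x i) := by
  rw [familyMeasure, familyMeasure, Measure.map_smul, ← Measure.mapₗ_apply_of_measurable hf, map_sum]
  simp only [Measure.mapₗ_apply_of_measurable hf, Measure.map_dirac' hf]

variable [MeasurableSingletonClass E]

theorem lintegral_familyMeasure (x : Fin N → E) (f : E → ℝ≥0∞) :
    ∫⁻ e, f e ∂(familyMeasure x) = (N : ℝ≥0∞)⁻¹ * ∑ i, f (x i) := by
  simp [familyMeasure]

theorem integrable_familyMeasure (hN : 0 < N) (x : Fin N → E) (f : E → ℝ) :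
    Integrable f (familyMeasure x) := by
  refine Integrable.smul_measure ?_ (by simp [hN.ne'])
  rw [integrable_finsetSum_measure]
  exact fun i _ => integrable_dirac (by simp)

theorem integral_familyMeasure (x : Fin N → E) (f : E → ℝ) :
    ∫ e, f e ∂(familyMeasure x) = 1 / (N : ℝ) * ∑ i, f (x i) := by
  rw [familyMeasure, integral_smul_measure,
    integral_finsetSum_measure fun i _ => integrable_dirac (by simp)]
  simp

theorem ae_mem_range_familyMeasure (x : Fin N → E) :
    ∀ᵐ e ∂(familyMeasure x), e ∈ Set.range x := by
  refine Measure.ae_smul_measure ?_ _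
  rw [ae_iff]
  simp [Measure.dirac_apply]

end FamilyMeasure

theorem ofReal_dist_sq {E : Type*} [PseudoMetricSpace E] (x y : E) :
    ENNReal.ofReal (dist x y ^ 2) = edist x y ^ 2 := by
  rw [edist_dist, ENNReal.ofReal_pow dist_nonneg]

theorem IsSumSq.eval_nonneg {ι : Type*} {p : MvPolynomial ι ℝ} (hp : IsSumSq p) (x : ι → ℝ) :
    0 ≤ MvPolynomial.eval x p := by
  induction hp with
  | zero => simp
  | sq_add a _ ih => rw [map_add, map_mul]; exact add_nonneg (mul_self_nonneg _) ih

/-! ### Weak duality. -/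

namespace PortfolioDRO

/-- The slack `ε² < c` avoids proving that an optimal coupling exists. -/
theorem exists_coupling_of_wasserstein_le {E : Type*} [MeasurableSpace E] [PseudoEMetricSpace E]
    {μ ν : Measure E} {ε c : ℝ} (hε : 0 ≤ ε) (h : wasserstein μ ν ≤ ENNReal.ofReal ε)
    (hc : ε ^ 2 < c) :
    ∃ π, IsCoupling π μ ν ∧ ∫⁻ p, edist p.1 p.2 ^ 2 ∂π ≤ ENNReal.ofReal c := by
  have hlt : ENNReal.ofReal ε < ENNReal.ofReal (√c) :=
    (ENNReal.ofReal_lt_ofReal_iff_of_nonneg hε).2 (Real.lt_sqrt_of_sq_lt hc)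
  obtain ⟨π, hπ⟩ := iInf_lt_iff.1 (h.trans_lt hlt)
  obtain ⟨hπc, hπ⟩ := iInf_lt_iff.1 hπ
  refine ⟨π, hπc, ?_⟩
  have := pow_le_pow_left₀ (zero_le) hπ.le 2
  rw [← ENNReal.ofReal_pow (Real.sqrt_nonneg _), Real.sq_sqrt (by nlinarith),
    ← ENNReal.rpow_natCast, ← ENNReal.rpow_mul] at this
  simpa using this

namespace Model

variable {m N : ℕ} (P : Model m N)

/-- The larger of the two loss pieces, as a function on the Euclidean space. -/
noncomputable def maxLoss (y : Fin m → ℝ) (τ : ℝ) (x : EuclideanSpace ℝ (Fin m)) : ℝ :=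
  max (MvPolynomial.eval (fun j => x j) (P.g 0 y τ)) (MvPolynomial.eval (fun j => x j) (P.g 1 y τ))

theorem continuous_eval_coords (p : MvPolynomial (Fin m) ℝ) :
    Continuous fun x : EuclideanSpace ℝ (Fin m) => MvPolynomial.eval (fun j => x j) p :=
  (MvPolynomial.continuous_eval p).comp (by fun_prop)

theorem continuous_maxLoss (y : Fin m → ℝ) (τ : ℝ) : Continuous (P.maxLoss y τ) :=
  (continuous_eval_coords _).max (continuous_eval_coords _)

theorem eval_φ (i : Fin N) (x : EuclideanSpace ℝ (Fin m)) :
    MvPolynomial.eval (fun j => x j) (P.φ i) = dist x (P.data i) ^ 2 := by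
  rw [EuclideanSpace.dist_eq, Real.sq_sqrt (by positivity)]
  simp [φ, Real.dist_eq, sq_abs]

theorem mem_support_iff (x : EuclideanSpace ℝ (Fin m)) :
    x ∈ P.support ↔ ∑ j, x j ^ 2 ≤ P.R ^ 2 := by
  simp [support, h]

theorem isCompact_support : IsCompact P.support := by
  refine (isCompact_closedBall (0 : EuclideanSpace ℝ (Fin m)) |P.R|).of_isClosed_subset
    (isClosed_le continuous_const (continuous_eval_coords _)) fun x hx => ?_
  rw [mem_closedBall_zero_iff, ← sq_le_sq₀ (norm_nonneg _) (abs_nonneg _), sq_abs,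
    EuclideanSpace.norm_sq_eq]
  simpa using (P.mem_support_iff x).1 hx

theorem empirical_eq : P.empirical = familyMeasure P.data := rfl

theorem maxLoss_le_of_feasible {r : ℕ} {z : Decision m N} (hz : z ∈ P.feasible r)
    {x : EuclideanSpace ℝ (Fin m)} (hx : x ∈ P.support) (i : Fin N) :
    P.maxLoss z.y z.τ x ≤ z.lam * dist x (P.data i) ^ 2 - z.α i := by
  have key (k : Fin 2) : MvPolynomial.eval (fun j => x j) (P.g k z.y z.τ) ≤
      z.lam * dist x (P.data i) ^ 2 - z.α i := by
    obtain ⟨h1, -, h2, -⟩ := hz.2.2 k i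
    have e1 := mul_nonneg (h1.eval_nonneg fun j => x j) hx
    have e2 := h2.eval_nonneg fun j => x j
    simp only [map_sub, map_add, map_neg, map_mul, MvPolynomial.eval_C, eval_φ] at e2
    linarith
  exact max_le (key 0) (key 1)

/-- Coinciding data points can be given the largest of their multipliers. -/
theorem exists_measurable_envelope (x : Fin N → EuclideanSpace ℝ (Fin m)) (α : Fin N → ℝ) :
    ∃ A : EuclideanSpace ℝ (Fin m) → ℝ, Measurable A ∧ (∀ i, α i ≤ A (x i)) ∧
      ∀ i, ∃ j, x j = x i ∧ A (x i) = α j := by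
  classical
  have hex (v : EuclideanSpace ℝ (Fin m)) (hv : v ∈ Set.range x) :
      ∃ j, x j = v ∧ ∀ i, x i = v → α i ≤ α j := by
    obtain ⟨i, rfl⟩ := hv
    have : Nonempty {j // x j = x i} := ⟨⟨i, rfl⟩⟩
    obtain ⟨⟨j, hj⟩, hmax⟩ := Finite.exists_max fun j : {j // x j = x i} => α j
    exact ⟨j, hj, fun k hk => hmax ⟨k, hk⟩⟩
  choose j hj hjmax using hex
  refine ⟨fun v => if hv : v ∈ Set.range x then α (j v hv) else 0,
    (measurable_const (a := (0 : ℝ))).measurable_of_countable_ne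
      ((Set.finite_range x).countable.mono fun v hv => ?_), fun i => ?_, fun i => ?_⟩
  · by_contra hv'
    exact hv (by simp only [dif_neg hv'])
  · simp only [Set.mem_range_self, dite_true]
    exact hjmax _ _ i rfl
  · exact ⟨j _ ⟨i, rfl⟩, hj _ _, by simp only [Set.mem_range_self, dite_true]⟩

theorem integrable_maxLoss {Q : Measure (EuclideanSpace ℝ (Fin m))} (hQ : Q ∈ P.ambiguitySet)
    (y : Fin m → ℝ) (τ : ℝ) : Integrable (P.maxLoss y τ) Q := by
  have := hQ.1
  have := (P.continuous_maxLoss y τ).continuousOn.integrableOn_compact (μ := Q) P.isCompact_support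
  rwa [IntegrableOn, Measure.restrict_eq_self_of_ae_mem] at this
  exact hQ.2.1

theorem expectedLoss_le_objective (hN : 0 < N) (hε : 0 ≤ P.ε) {r : ℕ} {z : Decision m N}
    (hz : z ∈ P.feasible r) {Q : Measure (EuclideanSpace ℝ (Fin m))} (hQ : Q ∈ P.ambiguitySet) :
    P.expectedLoss z.y z.τ Q ≤ P.objective z := by
  have := hQ.1
  -- A coupling sees the location of a data point and not its index, so `α` must become a function
  -- of location.
  obtain ⟨A, hAm, hAle, hA⟩ := exists_measurable_envelope P.data z.α
  have hlam : 0 ≤ z.lam := hz.2.1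
  have key (c : ℝ) (hc : P.ε ^ 2 < c) :
      P.expectedLoss z.y z.τ Q ≤ z.lam * c - 1 / (N : ℝ) * ∑ i, z.α i := by
    obtain ⟨π, ⟨hπ1, hπ2⟩, hπ⟩ := exists_coupling_of_wasserstein_le hε hQ.2.2 hc
    have hc0 : 0 ≤ c := by nlinarith
    simp only [← ofReal_dist_sq] at hπ
    have hdcont : Continuous fun p : EuclideanSpace ℝ (Fin m) × EuclideanSpace ℝ (Fin m) =>
      dist p.1 p.2 ^ 2 := by fun_prop
    have hdm := hdcont.aestronglyMeasurable (μ := π)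
    have hd : Integrable (fun p => dist p.1 p.2 ^ 2) π :=
      (lintegral_ofReal_ne_top_iff_integrable hdm (ae_of_all _ fun _ => by positivity)).1
        (ne_top_of_le_ne_top ENNReal.ofReal_ne_top hπ)
    have hdle : ∫ p, dist p.1 p.2 ^ 2 ∂π ≤ c := by
      rw [← ofReal_integral_eq_lintegral_ofReal hd (ae_of_all _ fun _ => by positivity)] at hπ
      exact (ENNReal.ofReal_le_ofReal_iff hc0).1 hπ
    have hl : Integrable (fun p => P.maxLoss z.y z.τ p.1) π :=
      (hπ1 ▸ P.integrable_maxLoss hQ z.y z.τ).comp_measurable measurable_fst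
    have hA1 : Integrable A (π.map Prod.snd) := by
      rw [hπ2]; exact integrable_familyMeasure hN _ _
    have hA2 : Integrable (fun p => A p.2) π := hA1.comp_measurable measurable_snd
    have hAint : 1 / (N : ℝ) * ∑ i, z.α i ≤ ∫ p, A p.2 ∂π := by
      rw [← integral_map (f := A) measurable_snd.aemeasurable hA1.1, hπ2, empirical_eq,
        integral_familyMeasure]
      gcongr with i
      exact hAle i
    have hlint : P.expectedLoss z.y z.τ Q = ∫ p, P.maxLoss z.y z.τ p.1 ∂π := by
      rw [← integral_map (f := P.maxLoss z.y z.τ) measurable_fst.aemeasurable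
        (P.continuous_maxLoss _ _).aestronglyMeasurable, hπ1]
      rfl
    have hsupp : ∀ᵐ p ∂π, p.1 ∈ P.support :=
      ae_of_ae_map measurable_fst.aemeasurable (hπ1 ▸ hQ.2.1)
    have hrange : ∀ᵐ p ∂π, p.2 ∈ Set.range P.data :=
      ae_of_ae_map measurable_snd.aemeasurable (hπ2 ▸ ae_mem_range_familyMeasure P.data)
    have hmono : ∫ p, P.maxLoss z.y z.τ p.1 ∂π ≤ ∫ p, (z.lam * dist p.1 p.2 ^ 2 - A p.2) ∂π := by
      refine integral_mono_ae hl ((hd.const_mul _).sub hA2) ?_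
      filter_upwards [hsupp, hrange] with p hp1 hp2
      obtain ⟨i, hi⟩ := hp2
      obtain ⟨j, hj, hAj⟩ := hA i
      rw [← hi, hAj, ← hj]
      exact P.maxLoss_le_of_feasible hz hp1 j
    rw [integral_sub (hd.const_mul _) hA2, integral_const_mul] at hmono
    rw [hlint]
    have := mul_le_mul_of_nonneg_left hdle hlam
    linarith
  refine le_of_forall_pos_le_add fun δ hδ => ?_
  -- The `+ 1` covers `λ = 0`.
  have h1 := key (P.ε ^ 2 + δ / (z.lam + 1)) (by linarith [div_pos hδ (by linarith : 0 < z.lam + 1)])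
  have h2 : z.lam * (δ / (z.lam + 1)) ≤ δ := by
    rw [mul_div_assoc', div_le_iff₀ (by linarith)]
    nlinarith
  rw [objective]
  linarith

theorem droValue_le_relaxValue (hN : 0 < N) (hε : 0 ≤ P.ε) (r : ℕ) :
    P.droValue ≤ P.relaxValue r :=
  le_iInf₂ fun z hz => iInf₂_le_of_le z.y hz.1 <| iInf_le_of_le z.τ <| iSup₂_le fun _ hQ =>
    EReal.coe_le_coe_iff.2 (P.expectedLoss_le_objective hN hε hz hQ)

theorem feasible_mono {r s : ℕ} (hrs : r ≤ s) : P.feasible r ⊆ P.feasible s :=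
  fun _ hz => ⟨hz.1, hz.2.1, fun k i =>
    let ⟨h1, h2, h3, h4⟩ := hz.2.2 k i
    ⟨h1, h2.trans (by omega), h3, h4.trans (by omega)⟩⟩

theorem relaxValue_antitone : Antitone P.relaxValue :=
  fun _ _ hrs => biInf_mono (P.feasible_mono hrs)

/-! ### Strong duality for the inner supremum. -/

/-- Average squared distance of a family of points to the data. -/
noncomputable def avgCost (x : Fin N → EuclideanSpace ℝ (Fin m)) : ℝ :=
  1 / (N : ℝ) * ∑ i, dist (x i) (P.data i) ^ 2

theorem lintegral_edist_sq_familyMeasure (hN : 0 < N) (x : Fin N → EuclideanSpace ℝ (Fin m)) :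
    ∫⁻ p, edist p.1 p.2 ^ 2 ∂(familyMeasure fun i => (x i, P.data i)) =
      ENNReal.ofReal (P.avgCost x) := by
  rw [lintegral_familyMeasure, avgCost, one_div, ENNReal.ofReal_mul (by positivity),
    ENNReal.ofReal_inv_of_pos (by positivity), ENNReal.ofReal_natCast,
    ENNReal.ofReal_sum_of_nonneg fun _ _ => by positivity]
  simp only [ofReal_dist_sq]

theorem familyMeasure_compl_support {x : Fin N → EuclideanSpace ℝ (Fin m)}
    (hx : ∀ i, x i ∈ P.support) : familyMeasure x P.supportᶜ = 0 := by
  have : ∀ᵐ e ∂(familyMeasure x), e ∈ P.support := by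
    filter_upwards [ae_mem_range_familyMeasure x] with e he
    obtain ⟨i, rfl⟩ := he
    exact hx i
  exact this

/-- Pairing each moved point with its own data point gives a coupling; mixing two of them keeps the
empirical marginal and averages the costs. -/
theorem mixture_mem_ambiguitySet (hN : 0 < N) (hε : 0 ≤ P.ε)
    {x x' : Fin N → EuclideanSpace ℝ (Fin m)} (hx : ∀ i, x i ∈ P.support)
    (hx' : ∀ i, x' i ∈ P.support) {w : ℝ} (hw : 0 ≤ w) (hw1 : w ≤ 1)
    (hcost : w * P.avgCost x + (1 - w) * P.avgCost x' ≤ P.ε ^ 2) :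
    ENNReal.ofReal w • familyMeasure x + ENNReal.ofReal (1 - w) • familyMeasure x' ∈
      P.ambiguitySet := by
  have hsum : ENNReal.ofReal w + ENNReal.ofReal (1 - w) = 1 := by
    rw [← ENNReal.ofReal_add hw (by linarith)]; simp
  have := isProbabilityMeasure_familyMeasure hN x
  have := isProbabilityMeasure_familyMeasure hN x'
  have hc0 (x : Fin N → EuclideanSpace ℝ (Fin m)) : 0 ≤ P.avgCost x := by
    unfold avgCost; positivity
  refine ⟨⟨by simpa using hsum⟩, ?_, ?_⟩
  · simp [P.familyMeasure_compl_support hx, P.familyMeasure_compl_support hx']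
  · refine iInf₂_le_of_le (ENNReal.ofReal w • familyMeasure (fun i => (x i, P.data i)) +
      ENNReal.ofReal (1 - w) • familyMeasure fun i => (x' i, P.data i)) ⟨?_, ?_⟩ ?_
    · rw [Measure.map_add _ _ measurable_fst, Measure.map_smul, Measure.map_smul,
        map_familyMeasure measurable_fst, map_familyMeasure measurable_fst]
    · rw [Measure.map_add _ _ measurable_snd, Measure.map_smul, Measure.map_smul,
        map_familyMeasure measurable_snd, map_familyMeasure measurable_snd, ← add_smul, hsum,
        one_smul]
      rfl
    · rw [lintegral_add_measure, lintegral_smul_measure, lintegral_smul_measure,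
        P.lintegral_edist_sq_familyMeasure hN, P.lintegral_edist_sq_familyMeasure hN, smul_eq_mul,
        smul_eq_mul, ← ENNReal.ofReal_mul hw, ← ENNReal.ofReal_mul (by linarith),
        ← ENNReal.ofReal_add (mul_nonneg hw (hc0 _)) (mul_nonneg (by linarith) (hc0 _)),
        ENNReal.ofReal_rpow_of_nonneg (add_nonneg (mul_nonneg hw (hc0 _))
          (mul_nonneg (by linarith) (hc0 _))) (by norm_num), ← Real.sqrt_eq_rpow]
      exact ENNReal.ofReal_le_ofReal (Real.sqrt_le_iff.2 ⟨hε, hcost⟩)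

theorem expectedLoss_mixture (hN : 0 < N) (x x' : Fin N → EuclideanSpace ℝ (Fin m)) {w : ℝ}
    (hw : 0 ≤ w) (hw1 : w ≤ 1) (y : Fin m → ℝ) (τ : ℝ) :
    P.expectedLoss y τ
        (ENNReal.ofReal w • familyMeasure x + ENNReal.ofReal (1 - w) • familyMeasure x') =
      w * (1 / (N : ℝ) * ∑ i, P.maxLoss y τ (x i)) +
        (1 - w) * (1 / (N : ℝ) * ∑ i, P.maxLoss y τ (x' i)) := by
  change ∫ e, P.maxLoss y τ e ∂_ = _
  rw [integral_add_measure
    ((integrable_familyMeasure hN _ _).smul_measure ENNReal.ofReal_ne_top)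
    ((integrable_familyMeasure hN _ _).smul_measure ENNReal.ofReal_ne_top),
    integral_smul_measure, integral_smul_measure, integral_familyMeasure, integral_familyMeasure,
    ENNReal.toReal_ofReal hw, ENNReal.toReal_ofReal (by linarith), smul_eq_mul, smul_eq_mul]

/-- Strong duality for the inner worst-case expectation. -/
theorem exists_dual_certificate (hN : 0 < N) (hε : 0 < P.ε) (hdata : ∀ i, P.data i ∈ P.support)
    {y : Fin m → ℝ} {τ v : ℝ} (hv : ∀ Q ∈ P.ambiguitySet, P.expectedLoss y τ Q ≤ v) :
    ∃ (l : ℝ) (α : Fin N → ℝ), 0 ≤ l ∧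
      (∀ x ∈ P.support, ∀ i, α i ≤ l * dist x (P.data i) ^ 2 - P.maxLoss y τ x) ∧
      l * P.ε ^ 2 - 1 / (N : ℝ) * ∑ i, α i ≤ v := by
  -- The multiplier ranges over families of `N` support points. The unmoved data has cost `0 < ε²`,
  -- which is the Slater point.
  obtain ⟨l, hl, hmul⟩ := exists_multiplier (X := Fin N → P.support)
    (fun x => P.avgCost fun i => x i) (fun x => 1 / (N : ℝ) * ∑ i, P.maxLoss y τ (x i))
    (c := P.ε ^ 2) (v := v) ⟨fun i => ⟨P.data i, hdata i⟩, by simpa [avgCost] using by positivity⟩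
    fun x x' w hw hw1 hcost => by
      rw [← P.expectedLoss_mixture hN _ _ hw hw1]
      exact hv _ (P.mixture_mem_ambiguitySet hN hε.le (fun i => (x i).2) (fun i => (x' i).2) hw hw1
        hcost)
  have hex (i : Fin N) : ∃ x ∈ P.support, ∀ x' ∈ P.support,
      l * dist x (P.data i) ^ 2 - P.maxLoss y τ x ≤ l * dist x' (P.data i) ^ 2 - P.maxLoss y τ x' :=
    P.isCompact_support.exists_isMinOn ⟨_, hdata i⟩
      (((by fun_prop : Continuous fun x => l * dist x (P.data i) ^ 2).sub
        (P.continuous_maxLoss y τ)).continuousOn)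
  choose x hx hmin using hex
  refine ⟨l, fun i => l * dist (x i) (P.data i) ^ 2 - P.maxLoss y τ (x i), hl,
    fun x' hx' i => hmin i x' hx', ?_⟩
  -- The penalized problem splits over `i`, so the family of separate minimizers attains the bound.
  have := hmul fun i => ⟨x i, hx i⟩
  simp only [avgCost] at this
  rw [Finset.sum_sub_distrib, ← Finset.mul_sum]
  linarith

/-! ### Convergence of the hierarchy. -/

theorem eventually_relaxValue_le (hN : 0 < N) (hR : 0 < P.R) (hε : 0 < P.ε)
    (hdata : ∀ i, P.data i ∈ P.support) {w : ℝ} (hw : P.droValue < w) :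
    ∀ᶠ r in atTop, P.relaxValue r ≤ w := by
  obtain ⟨y, hy⟩ := iInf_lt_iff.1 hw
  obtain ⟨hyΔ, hy⟩ := iInf_lt_iff.1 hy
  obtain ⟨τ, hτ⟩ := iInf_lt_iff.1 hy
  obtain ⟨v, hv, hvw⟩ := EReal.lt_iff_exists_real_btwn.1 hτ
  have hvw : v < w := EReal.coe_lt_coe_iff.1 hvw
  obtain ⟨l, α, hl, hα, hobj⟩ := P.exists_dual_certificate hN hε hdata (y := y) (τ := τ) (v := v)
    fun Q hQ => EReal.coe_le_coe_iff.1
      ((le_iSup₂ (f := fun Q _ => (P.expectedLoss y τ Q : EReal)) Q hQ).trans hv.le)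
  -- Lowering every `αᵢ` by `w - v` makes the polynomial at least `w - v > 0` on the ball and raises
  -- the objective by exactly `w - v`.
  have hput (k : Fin 2) (i : Fin N) := exists_isSumSq_add_mul_of_pos_on_ball hR
    (-P.g k y τ + MvPolynomial.C l * P.φ i - MvPolynomial.C (α i - (w - v))) (fun x hx => by
      have h1 := hα (WithLp.toLp 2 x) ((P.mem_support_iff _).2 hx) i
      have h2 : MvPolynomial.eval x (P.g k y τ) ≤ P.maxLoss y τ (WithLp.toLp 2 x) := by
        fin_cases k
        · exact le_max_left _ _
        · exact le_max_right _ _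
      have h3 := P.eval_φ i (WithLp.toLp 2 x)
      simp only at h3
      simp only [map_sub, map_add, map_neg, map_mul, MvPolynomial.eval_C] at h3 ⊢
      rw [h3]
      linarith)
  choose s t hs ht hst using hput
  have hst' (k i) : -P.g k y τ + MvPolynomial.C l * P.φ i - MvPolynomial.C (α i - (w - v))
      - t k i * P.h = s k i := by
    rw [hst k i, h]; ring
  -- The sum dominates all the degrees at once; the `+ 1` leaves room for `deg t ≤ 2(r - 1)`.
  filter_upwards [eventually_ge_atTop
    (∑ k, ∑ i, ((s k i).totalDegree + (t k i).totalDegree) + 1)] with r hr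
  have hdeg (k i) : (s k i).totalDegree + (t k i).totalDegree + 1 ≤ r := by
    refine le_trans (Nat.add_le_add_right ?_ 1) hr
    exact (Finset.single_le_sum (f := fun i => (s k i).totalDegree + (t k i).totalDegree)
      (fun _ _ => Nat.zero_le _) (Finset.mem_univ i)).trans
      (Finset.single_le_sum (f := fun k => ∑ i, ((s k i).totalDegree + (t k i).totalDegree))
        (fun _ _ => Nat.zero_le _) (Finset.mem_univ k))
  refine iInf₂_le_of_le ⟨y, τ, l, fun i => α i - (w - v), t⟩ ⟨hyΔ, hl, fun k i => ?_⟩ ?_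
  · have := hdeg k i
    simp only [hst']
    exact ⟨ht k i, by omega, hs k i, by omega⟩
  · rw [EReal.coe_le_coe_iff, objective]
    have hN' : (N : ℝ) ≠ 0 := by positivity
    simp only [Finset.sum_sub_distrib, Finset.sum_const, Finset.card_univ, Fintype.card_fin,
      nsmul_eq_mul]
    have e : 1 / (N : ℝ) * (N * w - N * v) = w - v := by field_simp
    rw [mul_sub (1 / (N : ℝ)), e]
    linarith

end Model

end PortfolioDRO

theorem proposition5p2 {m N : ℕ} (P : PortfolioDRO.Model m N) (hN : 0 < N)
    (hγ : 0 ≤ P.γ) (hη : 0 < P.η) (hη1 : P.η ≤ 1) (hR : 0 < P.R) (hε : 0 < P.ε)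
    (hdata : ∀ i, P.data i ∈ P.support)
    (hsol : ∃ y τ Q, P.IsSolution y τ Q)
    (hmin : ∀ r, P.IsLevel r → ∃ z, P.IsMinimizer r z) :
    (∀ r, P.IsLevel r →
      P.relaxValue (r + 1) ≤ P.relaxValue r ∧ P.droValue ≤ P.relaxValue (r + 1)) ∧
    Tendsto P.relaxValue atTop (𝓝 P.droValue) := by
  refine ⟨fun r _ => ⟨P.relaxValue_antitone r.le_succ, P.droValue_le_relaxValue hN hε.le _⟩,
    tendsto_order.2 ⟨fun a ha => .of_forall fun r =>
      ha.trans_le (P.droValue_le_relaxValue hN hε.le r), fun b hb => ?_⟩⟩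
  obtain ⟨w, hw, hwb⟩ := EReal.lt_iff_exists_real_btwn.1 hb
  exact (P.eventually_relaxValue_le hN hR hε hdata hw).mono fun r hr => hr.trans_lt hwb
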